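/- Let $p$ be an odd prime, $n\ge 0$ an integer, $K=\mathbb{Q}(\mu_{p^{n+1}})$ and $K^+$ its maximal real subfield. For $\mathrm{Re}(s)>1$ let $\zeta_{K^+}(s)=\prod_{\mathfrak p}(1-N\mathfrak p^{-s})^{-1}$, the product being over all nonzero prime ideals $\mathfrak p$ of the ring of integers of $K^+$, continued to a meromorphic function on $\mathbb{C}$ that is holomorphic on $\mathbb{C}\setminus\{1\}$, and let $$\zeta_{K^+,2}(s)=\prod_{\mathfrak p\mid 2}\bigl(1-N\mathfrak p^{1-s}\bigr)\cdot\zeta_{K^+}(s),$$ which extends uniquely to an entire function of $s$. For a primitive Dirichlet character $\chi$ whose conductor divides $p^{n+1}$ let $L_E(s,\chi)$ be the unique entire function of $s$ with $$L_E(s,\chi)=2\sum_{k=1}^{\infty}\frac{(-1)^k\chi(k)}{k^s}\qquad(\mathrm{Re}(s)>0).$$ Then these functions exist, and for all $s\in\mathbb{C}$ $$\zeta_{K^+,2}(s)=(-1)^{\varphi(p^{n+1})/2}\prod_{\chi\ \mathrm{even}}\frac12 L_E(s,\chi),$$ where $\varphi$ is Euler's totient function and the product is over all primitive Dirichlet characters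 $\chi$ of conductor dividing $p^{n+1}$ with $\chi(-1)=1$ (the primitive characters induced by the even characters of $\mathrm{Gal}(K/\mathbb{Q})\cong(\mathbb{Z}/p^{n+1}\mathbb{Z})^\times$). -/

import Mathlib

open Filter Topology NumberField IsDedekindDomain

namespace RefinedZeta

/-- The Euler factor `(1 - N𝔭 ^ (-s))⁻¹` at a finite place `𝔭` of the number field `F`. -/
noncomputable def eulerFactor {F : Type*} [Field F] [NumberField F]
    (v : HeightOneSpectrum (𝓞 F)) (s : ℂ) : ℂ :=
  (1 - (Ideal.absNorm v.asIdeal : ℂ) ^ (-s))⁻¹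

/-- `ζ` is the zeta function `ζ_S` of the number field `F`, where the set of places `S` consists of
the archimedean places and of the finite places in `S`: for `Re s > 1` it is the convergent
Euler product over the places outside `S`, and it is meromorphic on `ℂ` and holomorphic
away from `s = 1`. By the identity theorem this determines `ζ s` for `s ≠ 1`. -/
structure IsZetaS (F : Type*) [Field F] [NumberField F]
    (S : Finset (HeightOneSpectrum (𝓞 F))) (ζ : ℂ → ℂ) : Prop where
  hasProd : ∀ s : ℂ, 1 < s.re →
    HasProd (fun v : {v : HeightOneSpectrum (𝓞 F) // v ∉ S} => eulerFactor v.1 s) (ζ s)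
  differentiableOn : DifferentiableOn ℂ ζ {1}ᶜ
  meromorphicAt_one : MeromorphicAt ζ 1

/-- `Z` is the `(S, T)`-refined zeta function of `F`, for a finite set `S` as in `IsZetaS` and a
nonempty finite set `T` of finite places disjoint from `S`:
`Z s = ∏ 𝔭 ∈ T, (1 - N𝔭 ^ (1 - s)) * ζ_S s`. As `T` is nonempty, the singularity of the right-hand
side at `s = 1` is removable, and `Z` is the resulting entire function. -/
structure IsRefinedZeta (F : Type*) [Field F] [NumberField F]
    (S T : Finset (HeightOneSpectrum (𝓞 F))) (Z : ℂ → ℂ) : Prop where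
  differentiable : Differentiable ℂ Z
  eq_mul : ∃ ζ : ℂ → ℂ, IsZetaS F S ζ ∧ ∀ s : ℂ, s ≠ 1 →
    Z s = (∏ v ∈ T, (1 - (Ideal.absNorm v.asIdeal : ℂ) ^ (1 - s))) * ζ s

theorem finite_primesAboveTwo (F : Type*) [Field F] [NumberField F] :
    {v : HeightOneSpectrum (𝓞 F) | (2 : 𝓞 F) ∈ v.asIdeal}.Finite := by
  have h : Ideal.span {(2 : 𝓞 F)} ≠ 0 := by simp
  refine (Ideal.finite_factors h).subset fun v hv => ?_
  simpa [Ideal.dvd_span_singleton] using hv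

/-- The set of places of `F` above `2`. -/
noncomputable def primesAboveTwo (F : Type*) [Field F] [NumberField F] :
    Finset (HeightOneSpectrum (𝓞 F)) :=
  (finite_primesAboveTwo F).toFinset

/-- `L` is the Euler `L`-function of the Dirichlet character `χ`: it is entire, and for `Re s > 0`
its value is the sum of the (in general conditionally) convergent series
`2 * ∑_{k ≥ 1} (-1) ^ k * χ k / k ^ s`. -/
structure IsEulerLFunction {f : ℕ} (χ : DirichletCharacter ℂ f) (L : ℂ → ℂ) : Prop where
  differentiable : Differentiable ℂ L
  tendsto_sum : ∀ s : ℂ, 0 < s.re →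
    Tendsto (fun N : ℕ => 2 * ∑ k ∈ Finset.Icc 1 N, (-1 : ℂ) ^ k * χ (k : ZMod f) / (k : ℂ) ^ s)
      atTop (𝓝 (L s))

/-- The even Dirichlet characters modulo `m` (those with `χ (-1) = 1`). -/
noncomputable def evenCharacters (m : ℕ) [NeZero m] : Finset (DirichletCharacter ℂ m) :=
  (Set.toFinite {χ : DirichletCharacter ℂ m | χ.Even}).toFinset

end RefinedZeta

/-! Separating even and odd `k` in the alternating series gives `L_E(s, χ) / 2 = -(1 - χ(2) 2^(1-s))
L(s, χ)` for `χ` of odd conductor (`LFunction_alternating`). In the product over the `φ(p^(n+1)) /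
2` even characters, the signs give the power of `-1`, the factors `L(s, χ)` give `ζ_{K⁺}(s)`, and
the factors at `2` give the Euler factors above `2`.

The last two facts come from one local identity, `prod_primesAbove_one_sub`: for each prime `q` and
each `z`, `∏_{v ∣ q} (1 - Nv^z) = ∏_χ (1 - χ(q) q^z)`. It is used with `z = -s` at every `q`, and
with `z = 1 - s` at `q = 2`. For `q ≠ p` both sides are `(1 - q^(dz))^g`, where `d` is the order of
`q` in `(ℤ/p^(n+1))ˣ/{±1}`: on the left `d` is the residue degree, on the right the values `χ(q)`
are equidistributed over the `d`-th roots of unity. For `q = p` there is one prime, of norm `p`, and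
only the trivial character contributes.

Convergence of the alternating series for `Re s > 0` is Abel summation (`tendsto_sum_div_cpow`), and
uniqueness is the identity theorem. -/

namespace RefinedZeta

/-! ### Dirichlet series with bounded partial sums of coefficients -/

theorem sum_Icc_div_cpow_eq (a : ℕ → ℂ) (s : ℂ) (N : ℕ) :
    ∑ k ∈ Finset.Icc 1 N, a k / (k : ℂ) ^ s =
      (∑ k ∈ Finset.Icc 1 N, a k) * ((N + 1 : ℕ) : ℂ) ^ (-s) +
        ∑ j ∈ Finset.range N, (∑ k ∈ Finset.Icc 1 (j + 1), a k) *
          (((j + 1 : ℕ) : ℂ) ^ (-s) - ((j + 2 : ℕ) : ℂ) ^ (-s)) := by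
  induction N with
  | zero => simp
  | succ N ih =>
    rw [Finset.sum_Icc_succ_top (by omega), ih, Finset.sum_range_succ,
      Finset.sum_Icc_succ_top (by omega : 1 ≤ N + 1), div_eq_mul_inv, ← Complex.cpow_neg]
    ring_nf

/-- Mean value inequality for `t ↦ t ^ (-s)`, whose derivative is largest in norm at the left
endpoint. -/
theorem norm_natCast_cpow_sub_le {s : ℂ} (hs : 0 < s.re) (j : ℕ) :
    ‖((j + 1 : ℕ) : ℂ) ^ (-s) - ((j + 2 : ℕ) : ℂ) ^ (-s)‖ ≤
      ‖s‖ * ((j + 1 : ℕ) : ℝ) ^ (-s.re - 1) := by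
  have hs0 : s ≠ 0 := by rintro rfl; simp at hs
  have hpos : ∀ t ∈ Set.Icc ((j + 1 : ℕ) : ℝ) ((j + 2 : ℕ) : ℝ), 0 < t := fun t ht =>
    lt_of_lt_of_le (by positivity) ht.1
  have key := (convex_Icc ((j + 1 : ℕ) : ℝ) ((j + 2 : ℕ) : ℝ)).norm_image_sub_le_of_norm_hasDerivWithin_le
    (f := fun t : ℝ => (t : ℂ) ^ (-s)) (f' := fun t : ℝ => -s * (t : ℂ) ^ (-s - 1))
    (C := ‖s‖ * ((j + 1 : ℕ) : ℝ) ^ (-s.re - 1)) (x := ((j + 2 : ℕ) : ℝ)) (y := ((j + 1 : ℕ) : ℝ))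
    (fun t ht => ?_) (fun t ht => ?_) (by simp) (by simp)
  · have h1 : ‖((j + 1 : ℕ) : ℝ) - ((j + 2 : ℕ) : ℝ)‖ = 1 := by
      push_cast
      rw [show ((j : ℝ) + 1 - (j + 2)) = -1 by ring]; simp
    rw [h1, mul_one] at key
    simpa using key
  · have h0 := hpos t ht
    -- The library derivative is that of `t ^ (r + 1) / (r + 1)`, here with `r = -s - 1`;
    -- multiplying by `-s` cancels the denominator.
    have h1 : -s - 1 ≠ -1 := fun h => hs0 (by linear_combination -h)
    have h2 := ((hasDerivAt_ofReal_cpow_const' h0.ne' h1).const_mul (-s)).hasDerivWithinAt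
      (s := Set.Icc ((j + 1 : ℕ) : ℝ) ((j + 2 : ℕ) : ℝ))
    simpa [mul_div_cancel₀, hs0] using h2
  · have h0 := hpos t ht
    rw [norm_mul, norm_neg, Complex.norm_cpow_eq_rpow_re_of_pos h0]
    simp only [Complex.sub_re, Complex.neg_re, Complex.one_re]
    exact mul_le_mul_of_nonneg_left
      (Real.rpow_le_rpow_of_nonpos (by positivity) ht.1 (by linarith)) (norm_nonneg s)

/-- After Abel summation the series converges locally uniformly on `Re s > 0`, so its sum is
holomorphic there. It equals `L` for `Re s > 1`, hence on the whole half-plane. -/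
theorem tendsto_sum_div_cpow {a : ℕ → ℂ} {C : ℝ}
    (ha : ∀ N, ‖∑ k ∈ Finset.Icc 1 N, a k‖ ≤ C) {L : ℂ → ℂ} (hL : DifferentiableOn ℂ L {s | 0 < s.re})
    (hsum : ∀ s : ℂ, 1 < s.re → LSeriesSummable a s)
    (hLs : ∀ s : ℂ, 1 < s.re → L s = LSeries a s) {s : ℂ} (hs : 0 < s.re) :
    Tendsto (fun N : ℕ => ∑ k ∈ Finset.Icc 1 N, a k / (k : ℂ) ^ s) atTop (𝓝 (L s)) := by
  have hC : 0 ≤ C := (norm_nonneg _).trans (ha 0)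
  set D : ℕ → ℂ → ℂ := fun j s => (∑ k ∈ Finset.Icc 1 (j + 1), a k) *
          (((j + 1 : ℕ) : ℂ) ^ (-s) - ((j + 2 : ℕ) : ℂ) ^ (-s)) with hD
  have hDle : ∀ s : ℂ, 0 < s.re → ∀ j, ‖D j s‖ ≤ C * (‖s‖ * ((j + 1 : ℕ) : ℝ) ^ (-s.re - 1)) := by
    intro s hs j
    rw [hD, norm_mul]
    exact mul_le_mul (ha _) (norm_natCast_cpow_sub_le hs j) (norm_nonneg _) hC
  have hsumm : ∀ ε > (0 : ℝ), ∀ R : ℝ,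
      Summable fun j : ℕ => C * (R * ((j + 1 : ℕ) : ℝ) ^ (-ε - 1)) := by
    intro ε hε R
    exact (((summable_nat_add_iff 1).mpr
      (Real.summable_nat_rpow.mpr (by linarith : -ε - 1 < -1))).mul_left R).mul_left C
  have hDsumm : ∀ s : ℂ, 0 < s.re → Summable (D · s) := fun s hs =>
    .of_norm_bounded (hsumm _ hs ‖s‖) (hDle s hs)
  have hdiff : DifferentiableOn ℂ (fun s => ∑' j, D j s) {s | 0 < s.re} := by
    intro s hs
    have hs : 0 < s.re := hs
    -- On `U` both `‖z‖` and `-z.re` are bounded above, which makes the majorant of `D j z`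
    -- independent of `z`.
    let U : Set ℂ := {z | s.re / 2 < z.re} ∩ {z | ‖z‖ < ‖s‖ + 1}
    have hU : IsOpen U := (isOpen_lt continuous_const Complex.continuous_re).inter
      (isOpen_lt continuous_norm continuous_const)
    have hsU : s ∈ U := ⟨by simp only [Set.mem_ofPred_eq]; linarith, by simp⟩
    refine DifferentiableAt.differentiableWithinAt ?_
    refine (Complex.differentiableOn_tsum_of_summable_norm (hsumm (s.re / 2) (by linarith) (‖s‖ + 1))
      (fun j => ?_) hU (fun j z hz => ?_)).differentiableAt (hU.mem_nhds hsU)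
    · have h1 : ((j + 1 : ℕ) : ℂ) ≠ 0 := Nat.cast_ne_zero.mpr (by omega)
      have h2 : ((j + 2 : ℕ) : ℂ) ≠ 0 := Nat.cast_ne_zero.mpr (by omega)
      refine Differentiable.differentiableOn fun z => ?_
      exact ((differentiableAt_id.neg.const_cpow (.inl h1)).sub
        (differentiableAt_id.neg.const_cpow (.inl h2))).const_mul _
    · have hz1 : s.re / 2 < z.re := hz.1
      have hz2 : ‖z‖ < ‖s‖ + 1 := hz.2
      refine (hDle z (by linarith) j).trans ?_
      gcongr
      exact_mod_cast Nat.succ_le_succ (Nat.zero_le j)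
  have htend : ∀ s : ℂ, 0 < s.re → Tendsto (fun N : ℕ => ∑ k ∈ Finset.Icc 1 N, a k / (k : ℂ) ^ s)
      atTop (𝓝 (∑' j, D j s)) := by
    intro s hs
    have h0 : Tendsto (fun N : ℕ => (∑ k ∈ Finset.Icc 1 N, a k) * ((N + 1 : ℕ) : ℂ) ^ (-s))
        atTop (𝓝 0) := by
      have h1 : Tendsto (fun N : ℕ => C * ((N + 1 : ℕ) : ℝ) ^ (-s.re)) atTop (𝓝 (C * 0)) :=
        (((tendsto_rpow_neg_atTop hs).comp tendsto_natCast_atTop_atTop).comp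
          (tendsto_add_atTop_nat 1)).const_mul C
      rw [mul_zero] at h1
      refine squeeze_zero_norm (fun N => ?_) h1
      rw [norm_mul, Complex.norm_natCast_cpow_of_pos N.succ_pos, Complex.neg_re]
      gcongr
      exact ha N
    have h2 := h0.add (hDsumm s hs).hasSum.tendsto_sum_nat
    rw [zero_add] at h2
    refine h2.congr fun N => (sum_Icc_div_cpow_eq a s N).symm
  suffices h : Set.EqOn L (fun s => ∑' j, D j s) {s | 0 < s.re} by
    rw [h hs]; exact htend s hs
  have hopen : IsOpen {s : ℂ | 0 < s.re} := isOpen_lt continuous_const Complex.continuous_re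
  refine (hL.analyticOnNhd hopen).eqOn_of_preconnected_of_eventuallyEq (hdiff.analyticOnNhd hopen)
    (convex_halfSpace_re_gt 0).isPreconnected (z₀ := 2) (by simp) ?_
  filter_upwards [(isOpen_lt continuous_const Complex.continuous_re).mem_nhds
    (show (1 : ℝ) < (2 : ℂ).re by simp)] with z hz
  have hz : 1 < z.re := hz
  rw [hLs z hz]
  refine tendsto_nhds_unique ?_ (htend z (by linarith))
  have h3 := (hsum z hz).hasSum.tendsto_sum_nat.comp (tendsto_add_atTop_nat 1)
  refine h3.congr fun N => ?_
  rw [Function.comp_apply, Finset.sum_range_succ', LSeries.term_zero, add_zero,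
    Finset.range_eq_Ico, Finset.sum_Ico_add' (LSeries.term a z) 0 N 1]
  rw [zero_add, Finset.Ico_add_one_right_eq_Icc]
  refine Finset.sum_congr rfl fun k hk => ?_
  rw [LSeries.term_of_ne_zero (by have := (Finset.mem_Icc.mp hk).1; omega)]

theorem IsEulerLFunction.unique {f : ℕ} {χ : DirichletCharacter ℂ f} {L L' : ℂ → ℂ}
    (hL : IsEulerLFunction χ L) (hL' : IsEulerLFunction χ L') : L = L' := by
  refine AnalyticOnNhd.eq_of_eventuallyEq (z₀ := 1) (fun z _ => hL.differentiable.analyticAt z)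
    (fun z _ => hL'.differentiable.analyticAt z) ?_
  filter_upwards [(isOpen_lt continuous_const Complex.continuous_re).mem_nhds
    (show (0 : ℝ) < (1 : ℂ).re by simp)] with z hz
  exact tendsto_nhds_unique (hL.tendsto_sum z hz) (hL'.tendsto_sum z hz)

/-! ### The alternating twist of a character of odd modulus -/

section EulerL

variable {f : ℕ}

/-- The function `k ↦ (-1) ^ k * χ k`, which for odd `f` is periodic modulo `2 * f`. -/
noncomputable def alternating (χ : DirichletCharacter ℂ f) (j : ZMod (2 * f)) : ℂ :=
  (-1) ^ j.val * χ (j.val : ZMod f)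

theorem alternating_natCast (χ : DirichletCharacter ℂ f) (k : ℕ) :
    alternating χ (k : ZMod (2 * f)) = (-1) ^ k * χ (k : ZMod f) := by
  have h1 : (-1 : ℂ) ^ (k % (2 * f)) = (-1) ^ k := by
    rw [neg_one_pow_eq_pow_mod_two, Nat.mod_mul_right_mod, ← neg_one_pow_eq_pow_mod_two]
  have h2 : ((k % (2 * f) : ℕ) : ZMod f) = k := by
    rw [ZMod.natCast_eq_natCast_iff', Nat.mod_mod_of_dvd _ (Dvd.intro_left 2 rfl)]
  rw [alternating, ZMod.val_natCast, h1, h2]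

theorem alternating_natCast_add (hf : Odd f) (χ : DirichletCharacter ℂ f) (k : ℕ) :
    alternating χ ((k + f : ℕ) : ZMod (2 * f)) = -alternating χ (k : ZMod (2 * f)) := by
  rw [alternating_natCast, alternating_natCast, pow_add, hf.neg_one_pow]
  simp

variable [NeZero f]

/-- A shift by the odd number `f` changes the sign. The vanishing sum removes the pole at `1`, so
that `ZMod.LFunction` is entire. -/
theorem sum_alternating (hf : Odd f) (χ : DirichletCharacter ℂ f) :
    ∑ j, alternating χ j = 0 := by
  have h : ∑ j, alternating χ j = ∑ j, alternating χ (j + (f : ZMod (2 * f))) :=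
    (Equiv.sum_comp (Equiv.addRight (f : ZMod (2 * f))) (alternating χ)).symm
  have h2 : ∀ j : ZMod (2 * f), alternating χ (j + (f : ZMod (2 * f))) = -alternating χ j := by
    intro j
    have := alternating_natCast_add hf χ j.val
    rwa [Nat.cast_add, ZMod.natCast_zmod_val] at this
  simp_rw [h2, Finset.sum_neg_distrib] at h
  exact self_eq_neg.mp h

theorem exists_norm_sum_alternating_le (hf : Odd f) (χ : DirichletCharacter ℂ f) :
    ∃ C, ∀ N : ℕ, ‖∑ k ∈ Finset.Icc 1 N, alternating χ (k : ZMod (2 * f))‖ ≤ C := by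
  set S : ℕ → ℂ := fun N => ∑ k ∈ Finset.Icc 1 N, alternating χ (k : ZMod (2 * f)) with hS
  have hsucc : ∀ N, S (N + 1) = S N + alternating χ ((N + 1 : ℕ) : ZMod (2 * f)) := fun N =>
    Finset.sum_Icc_succ_top (by omega) _
  -- Antiperiodicity of the summand gives this relation; applying it twice shows that `S` is `2 *
  -- f`-periodic, hence bounded.
  have h1 : ∀ N, S (N + f) + S N = S f := by
    intro N
    induction N with
    | zero => simp [hS]
    | succ N ih =>
      rw [show N + 1 + f = (N + f) + 1 by ring, hsucc, hsucc,
        show N + f + 1 = (N + 1) + f by ring, alternating_natCast_add hf, ← ih]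
      ring
  have h2 : Function.Periodic S (2 * f) := fun N => by
    have ha := h1 (N + f)
    have hb := h1 N
    rw [show N + 2 * f = N + f + f by ring]
    linear_combination ha - hb
  refine ⟨∑ r ∈ Finset.range (2 * f), ‖S r‖, fun N => ?_⟩
  have hlt : N % (2 * f) ∈ Finset.range (2 * f) :=
    Finset.mem_range.mpr (Nat.mod_lt _ (NeZero.pos _))
  change ‖S N‖ ≤ _
  rw [← h2.map_mod_nat N]
  exact Finset.single_le_sum (f := fun r => ‖S r‖) (fun _ _ => norm_nonneg _) hlt

/-- With `E` and `O` the even and odd parts of the `L`-series, the twist is `E - O = 2E - (E + O)`,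
and `E` is `χ 2 * 2 ^ (-s)` times the whole series. -/
theorem LSeries_alternating (χ : DirichletCharacter ℂ f) {s : ℂ} (hs : 1 < s.re) :
    LSeries (fun k : ℕ => alternating χ (k : ZMod (2 * f))) s =
      -(1 - χ 2 * 2 ^ (1 - s)) * LSeries (fun k : ℕ => χ (k : ZMod f)) s := by
  set t := LSeries.term (fun k : ℕ => χ (k : ZMod f)) s with ht
  set t' := LSeries.term (fun k : ℕ => alternating χ (k : ZMod (2 * f))) s with ht'
  have hsum : Summable t := ZMod.LSeriesSummable_of_one_lt_re (fun j => χ j) hs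
  have hdouble : ∀ k, t (2 * k) = χ 2 * 2 ^ (-s) * t k := by
    intro k
    rcases eq_or_ne k 0 with rfl | hk
    · simp [ht]
    · rw [ht, LSeries.term_of_ne_zero (by omega), LSeries.term_of_ne_zero hk]
      simp only [Nat.cast_mul, Nat.cast_ofNat, map_mul]
      rw [show (2 : ℂ) = ((2 : ℕ) : ℂ) by norm_num, Complex.natCast_mul_natCast_cpow,
        Complex.cpow_neg]
      ring
  have hE : HasSum (fun k => t (2 * k)) (χ 2 * 2 ^ (-s) * ∑' k, t k) := by
    simp_rw [hdouble]; exact hsum.hasSum.mul_left _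
  have hO : Summable fun k => t (2 * k + 1) :=
    hsum.comp_injective (i := fun k : ℕ => 2 * k + 1) fun a b h => by simpa using h
  have h1 := hE.even_add_odd hO.hasSum
  have hE' : HasSum (fun k => t' (2 * k)) (χ 2 * 2 ^ (-s) * ∑' k, t k) := by
    refine hE.congr_fun fun k => ?_
    rcases eq_or_ne k 0 with rfl | hk
    · simp [ht, ht']
    · rw [ht, ht', LSeries.term_of_ne_zero (by omega), LSeries.term_of_ne_zero (by omega),
        alternating_natCast, (even_two_mul k).neg_one_pow, one_mul]
  have hO' : HasSum (fun k => t' (2 * k + 1)) (-∑' k, t (2 * k + 1)) := by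
    refine HasSum.congr_fun hO.hasSum.neg fun k => ?_
    rw [ht, ht', LSeries.term_of_ne_zero (by omega), LSeries.term_of_ne_zero (by omega),
      alternating_natCast, (odd_two_mul_add_one k).neg_one_pow, neg_one_mul, neg_div]
  have h2 := (hE'.even_add_odd hO').tsum_eq
  have h3 := h1.tsum_eq
  have h4 : (2 : ℂ) ^ (1 - s) = 2 * 2 ^ (-s) := by
    rw [sub_eq_add_neg, Complex.cpow_add _ _ two_ne_zero, Complex.cpow_one]
  change ∑' k, t' k = _ * ∑' k, t k
  rw [h2, h4]
  linear_combination h3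

theorem LFunction_alternating (hf : Odd f) (χ : DirichletCharacter ℂ f) {s : ℂ} (hs : s ≠ 1) :
    ZMod.LFunction (alternating χ) s = -(1 - χ 2 * 2 ^ (1 - s)) * χ.LFunction s := by
  have hpc : IsPreconnected ({1}ᶜ : Set ℂ) :=
    (isConnected_compl_singleton_of_one_lt_rank (Complex.rank_real_complex ▸ Nat.one_lt_ofNat)
      _).isPreconnected
  have hL : DifferentiableOn ℂ (ZMod.LFunction (alternating χ)) {1}ᶜ :=
    (ZMod.differentiable_LFunction_of_sum_zero (sum_alternating hf χ)).differentiableOn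
  have hR : DifferentiableOn ℂ (fun s => -(1 - χ 2 * 2 ^ (1 - s)) * χ.LFunction s) {1}ᶜ := by
    intro z hz
    refine DifferentiableAt.differentiableWithinAt (.mul ?_
      (χ.differentiableAt_LFunction z (.inl hz)))
    exact (((((differentiableAt_const _).sub differentiableAt_id).const_cpow
      (.inl two_ne_zero)).const_mul _).const_sub _).neg
  refine (hL.analyticOnNhd isOpen_compl_singleton).eqOn_of_preconnected_of_eventuallyEq
    (hR.analyticOnNhd isOpen_compl_singleton) hpc (z₀ := 2) (by simp) ?_ hs
  filter_upwards [(isOpen_lt continuous_const Complex.continuous_re).mem_nhds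
    (show (1 : ℝ) < (2 : ℂ).re by simp)] with z hz
  have hz : 1 < z.re := hz
  rw [ZMod.LFunction_eq_LSeries _ hz, LSeries_alternating χ hz, χ.LFunction_eq_LSeries hz]

theorem isEulerLFunction_LFunction_alternating (hf : Odd f) (χ : DirichletCharacter ℂ f) :
    IsEulerLFunction χ (fun s => 2 * ZMod.LFunction (alternating χ) s) := by
  have hdiff := ZMod.differentiable_LFunction_of_sum_zero (sum_alternating hf χ)
  refine ⟨hdiff.const_mul 2, fun s hs => ?_⟩
  obtain ⟨C, hC⟩ := exists_norm_sum_alternating_le hf χ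
  have h := (tendsto_sum_div_cpow hC hdiff.differentiableOn
    (fun s hs => ZMod.LSeriesSummable_of_one_lt_re _ hs)
    (fun s hs => ZMod.LFunction_eq_LSeries _ hs) hs).const_mul 2
  simpa only [alternating_natCast] using h

end EulerL

/-! ### Values of even characters at a unit -/

section Characters

/-- A finite subgroup of `ℂˣ` is cyclic, so it consists of all roots of unity of order dividing its
cardinality. -/
theorem prod_one_sub_eq_of_subgroup (R : Subgroup ℂˣ) [Finite R] (X : ℂ) :
    ∏ᶠ z : R, (1 - ((z : ℂˣ) : ℂ) * X) = 1 - X ^ Nat.card R := by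
  have := Fintype.ofFinite R
  obtain ⟨g, hg⟩ := IsCyclic.exists_generator (α := R)
  have hcard : orderOf g = Nat.card R := orderOf_eq_card_of_forall_mem_zpowers hg
  have hprim : IsPrimitiveRoot (((g : R) : ℂˣ) : ℂ) (Nat.card R) := by
    rw [IsPrimitiveRoot.coe_units_iff, ← hcard, ← Subgroup.orderOf_coe]
    exact IsPrimitiveRoot.orderOf _
  have h := hprim.pow_sub_pow_eq_prod_sub_mul 1 X Nat.card_pos
  rw [one_pow] at h
  rw [h, finprod_eq_prod_of_fintype]
  refine Finset.prod_bij (fun z _ => ((z : ℂˣ) : ℂ)) (fun z _ => ?_) (fun a _ b _ hab => ?_)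
    (fun z hz => ?_) (fun z _ => rfl)
  · rw [Polynomial.mem_nthRootsFinset Nat.card_pos]
    have h1 : z ^ Nat.card R = 1 := pow_card_eq_one'
    rw [← Units.val_pow_eq_pow_val, ← Subgroup.coe_pow, h1, Subgroup.coe_one, Units.val_one]
  · exact Subtype.ext (Units.ext hab)
  · rw [Polynomial.mem_nthRootsFinset Nat.card_pos] at hz
    obtain ⟨i, -, hi⟩ := hprim.eq_pow_of_pow_eq_one hz
    exact ⟨g ^ i, Finset.mem_univ _, by simpa using hi⟩

theorem prod_one_sub_monoidHom {Y : Type*} [CommGroup Y] [Fintype Y] (e : Y →* ℂˣ) (X : ℂ) :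
    ∏ y, (1 - (e y : ℂ) * X) = (1 - X ^ Nat.card e.range) ^ Nat.card e.ker := by
  classical
  have := Fintype.ofFinite e.range
  rw [← prod_one_sub_eq_of_subgroup, finprod_eq_prod_of_fintype, ← Finset.prod_pow]
  change ∏ y, (1 - ((e.rangeRestrict y : ℂˣ) : ℂ) * X) = _
  rw [← Finset.prod_fiberwise' Finset.univ e.rangeRestrict (fun z => 1 - ((z : ℂˣ) : ℂ) * X)]
  refine Finset.prod_congr rfl fun z _ => ?_
  rw [Finset.prod_const]
  congr 1
  obtain ⟨y, hy⟩ := e.rangeRestrict_surjective z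
  have h1 : ∀ a, e.rangeRestrict a = 1 ↔ a ∈ e.ker := fun a => by
    rw [MonoidHom.mem_ker, Subtype.ext_iff]; rfl
  rw [MonoidHom.card_fiber_eq_of_mem_range e.rangeRestrict (y := 1) ⟨y, hy⟩ ⟨1, map_one _⟩]
  rw [Nat.card_eq_fintype_card, Fintype.card_subtype]
  simp_rw [h1]

variable {m : ℕ} [NeZero m]

theorem mem_evenCharacters {χ : DirichletCharacter ℂ m} : χ ∈ evenCharacters m ↔ χ.Even := by
  simp [evenCharacters]

/-- Even characters form the annihilator of `⟨-1⟩`, which makes the duality between subgroups of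
units and of characters available. -/
theorem mem_subgroupMulChar_neg_one_iff {χ : DirichletCharacter ℂ m} :
    χ ∈ (MulChar.subgroupOrderIsoSubgroupMulChar (ZMod m) ℂ
      (Subgroup.zpowers (-1))).ofDual ↔ χ ∈ evenCharacters m := by
  rw [MulChar.mem_subgroupOrderIsoSubgroupMulChar_iff, mem_evenCharacters, DirichletCharacter.Even]
  refine ⟨fun h => by simpa using h (-1) (Subgroup.mem_zpowers _), fun h u hu => ?_⟩
  obtain ⟨k, rfl⟩ := Subgroup.mem_zpowers_iff.mp hu
  have h1 : χ.toUnitHom (-1) = 1 := by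
    rw [Units.ext_iff, MulChar.coe_toUnitHom]; simpa using h
  rw [← MulChar.coe_toUnitHom, map_zpow, h1, one_zpow, Units.val_one]

theorem card_evenCharacters :
    (evenCharacters m).card = (Subgroup.zpowers (-1 : (ZMod m)ˣ)).index := by
  rw [Subgroup.index, ← MulChar.card_subgroupOrderIsoSubgroupMulChar (R := ℂ),
    ← Nat.card_eq_finsetCard]
  exact Nat.card_congr (Equiv.subtypeEquivRight fun χ => mem_subgroupMulChar_neg_one_iff.symm)

theorem prod_evenCharacters_one_sub (u : (ZMod m)ˣ) (X : ℂ) :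
    ∃ g : ℕ, g * (Subgroup.zpowers (-1)).relIndex (Subgroup.zpowers u) =
        (evenCharacters m).card ∧
      ∏ χ ∈ evenCharacters m, (1 - χ u * X) =
        (1 - X ^ (Subgroup.zpowers (-1)).relIndex (Subgroup.zpowers u)) ^ g := by
  classical
  set Y := (MulChar.subgroupOrderIsoSubgroupMulChar (ZMod m) ℂ
      (Subgroup.zpowers (-1))).ofDual with hY
  have := Fintype.ofFinite Y
  let e : Y →* ℂˣ := ((MonoidHom.eval u).comp
    (MulChar.mulEquivToUnitHom (R := ZMod m) (R' := ℂ)).toMonoidHom).comp Y.subtype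
  have he : ∀ χ : Y, (e χ : ℂ) = χ.1 u := fun χ => rfl
  have hrange : Nat.card e.range = (Subgroup.zpowers (-1)).relIndex (Subgroup.zpowers u) := by
    rw [← QuotientGroup.ker_mk' (Subgroup.zpowers (-1 : (ZMod m)ˣ)), Subgroup.relIndex_ker,
      MonoidHom.map_zpowers, Nat.card_zpowers, ← IsCyclic.exponent_eq_card]
    -- Both numbers have the same multiples: `k` kills the image of `e` iff every even character is
    -- trivial at `u ^ k`, which by duality means `u ^ k ∈ ⟨-1⟩`.
    refine Nat.dvd_right_iff_eq.mp fun k => ?_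
    rw [orderOf_dvd_iff_pow_eq_one, ← map_pow, ← MonoidHom.mem_ker, QuotientGroup.ker_mk',
      Monoid.exponent_dvd_iff_forall_pow_eq_one]
    rw [← (MulChar.subgroupOrderIsoSubgroupMulChar (ZMod m) ℂ).symm_apply_apply
      (Subgroup.zpowers (-1)), ← OrderDual.toDual_ofDual ((MulChar.subgroupOrderIsoSubgroupMulChar
        (ZMod m) ℂ) _), MulChar.mem_subgroupOrderIsoSubgroupMulChar_symm_iff]
    constructor
    · intro h χ hχ
      have := h ⟨e ⟨χ, hχ⟩, ⟨χ, hχ⟩, rfl⟩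
      rw [Subtype.ext_iff, Units.ext_iff] at this
      simpa [he] using this
    · rintro h ⟨_, χ, rfl⟩
      rw [Subtype.ext_iff, Units.ext_iff]
      simpa [he] using h χ.1 χ.2
  refine ⟨Nat.card e.ker, ?_, ?_⟩
  · rw [← hrange, mul_comm, ← Subgroup.index_ker, mul_comm, Subgroup.card_mul_index]
    rw [card_evenCharacters, Subgroup.index, ← MulChar.card_subgroupOrderIsoSubgroupMulChar (R := ℂ)]
  · rw [← hrange, ← prod_one_sub_monoidHom]
    simp_rw [he]
    refine (Finset.prod_subtype _ (fun χ => ?_) (fun χ : DirichletCharacter ℂ m => 1 - χ u * X))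
    rw [hY, mem_subgroupMulChar_neg_one_iff]

end Characters

open IsCyclotomicExtension.Rat IsCMField MulAction
open scoped Pointwise

/-! ### Splitting of unramified primes in the maximal real subfield -/

section Splitting

variable (m : ℕ) [NeZero m] (K : Type*) [Field K] [NumberField K]
  [IsCyclotomicExtension {m} ℚ K]

theorem card_gal_maximalRealSubfield [IsCMField K] :
    Nat.card Gal(K/maximalRealSubfield K) = 2 := by
  rw [IsGalois.card_aut_eq_finrank, Algebra.IsQuadraticExtension.finrank_eq_two]

/-- Complex conjugation inverts roots of unity. -/
theorem galEquivZMod_complexConj [IsCMField K] :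
    galEquivZMod m K (AlgEquiv.restrictScalarsHom ℚ (complexConj K)) = -1 := by
  have hζ := IsCyclotomicExtension.zeta_spec m ℚ K
  set ζ := IsCyclotomicExtension.zeta m ℚ K
  set u := galEquivZMod m K (AlgEquiv.restrictScalarsHom ℚ (complexConj K)) with hu
  have h1 : complexConj K ζ = ζ ^ u.val.val :=
    galEquivZMod_apply_of_pow_eq m K (AlgEquiv.restrictScalarsHom ℚ (complexConj K)) hζ.pow_eq_one
  have h2 : complexConj K ζ = ζ⁻¹ := by
    let z : (𝓞 K)ˣ := hζ.toInteger_isPrimitiveRoot.isUnit (NeZero.ne m) |>.unit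
    have hz : z ∈ Units.torsion K := by
      rw [Units.torsion, CommGroup.mem_torsion, isOfFinOrder_iff_pow_eq_one]
      refine ⟨m, NeZero.pos m, Units.ext ?_⟩
      simpa [z] using hζ.toInteger_isPrimitiveRoot.pow_eq_one
    exact complexConj_torsion K ⟨z, hz⟩
  have hζ0 : ζ ≠ 0 := hζ.ne_zero (NeZero.ne m)
  have h3 : ζ ^ (u.val.val + 1) = 1 := by
    rw [pow_succ, ← h1, h2, inv_mul_cancel₀ hζ0]
  have h4 : ((u.val.val + 1 : ℕ) : ZMod m) = 0 :=
    (ZMod.natCast_eq_zero_iff _ _).mpr ((hζ.pow_eq_one_iff_dvd _).mp h3)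
  rw [Nat.cast_add, ZMod.natCast_zmod_val, Nat.cast_one] at h4
  rw [Units.ext_iff, Units.val_neg, Units.val_one]
  exact eq_neg_of_add_eq_zero_left h4

/-- The embedding of `Gal(K/K⁺)` into `(ℤ/mℤ)ˣ`. -/
noncomputable def galRealEmbedding : Gal(K/maximalRealSubfield K) →* (ZMod m)ˣ :=
  (galEquivZMod m K).toMonoidHom.comp (AlgEquiv.restrictScalarsHom ℚ)

theorem galRealEmbedding_injective : Function.Injective (galRealEmbedding m K) :=
  (galEquivZMod m K).injective.comp (AlgEquiv.restrictScalarsHom_injective ℚ)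

theorem range_galRealEmbedding [IsCMField K] :
    (galRealEmbedding m K).range = Subgroup.zpowers (-1) := by
  rw [MonoidHom.range_eq_map, ← zpowers_complexConj_eq_top, MonoidHom.map_zpowers]
  congr 1
  exact galEquivZMod_complexConj m K

theorem index_zpowers_neg_one [IsCMField K] :
    (Subgroup.zpowers (-1 : (ZMod m)ˣ)).index = Module.finrank ℚ (maximalRealSubfield K) := by
  have h1 : Nat.card (Subgroup.zpowers (-1 : (ZMod m)ˣ)) = 2 := by
    rw [← range_galRealEmbedding m K, ← card_gal_maximalRealSubfield K]
    exact (Nat.card_congr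
      (MonoidHom.ofInjective (galRealEmbedding_injective m K)).toEquiv).symm
  have h2 := Subgroup.card_mul_index (Subgroup.zpowers (-1 : (ZMod m)ˣ))
  have h3 := Module.finrank_mul_finrank ℚ (maximalRealSubfield K) K
  rw [Algebra.IsQuadraticExtension.finrank_eq_two (maximalRealSubfield K) K, IsCyclotomicExtension.finrank (n := m) K
    (Polynomial.cyclotomic.irreducible_rat (NeZero.pos m))] at h3
  rw [h1, Nat.card_eq_fintype_card, ZMod.card_units_eq_totient, ← h3, mul_comm] at h2
  exact Nat.eq_of_mul_eq_mul_right two_pos h2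

variable (q : ℕ) [hq : Fact q.Prime]

/-- The decomposition group in `Gal(K/ℚ)` is generated by `q`; intersecting it with `Gal(K/K⁺) =
⟨-1⟩` gives the one over `K⁺`. -/
theorem card_stabilizer_galReal [IsCMField K] (hqm : q.Coprime m) (P : Ideal (𝓞 K)) [P.IsMaximal]
    [P.LiesOver (Ideal.span {(q : ℤ)})] :
    Nat.card (stabilizer Gal(K/maximalRealSubfield K) P) =
      Nat.card (Subgroup.zpowers (-1) ⊓ Subgroup.zpowers (ZMod.unitOfCoprime q hqm) :
        Subgroup (ZMod m)ˣ) := by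
  have h : (stabilizer Gal(K/maximalRealSubfield K) P).map (galRealEmbedding m K) =
      Subgroup.zpowers (-1) ⊓ Subgroup.zpowers (ZMod.unitOfCoprime q hqm) := by
    rw [← range_galRealEmbedding m K, ← galEquivZMod_stabilizer m K q P hqm]
    ext u
    constructor
    · rintro ⟨σ, hσ, rfl⟩
      exact ⟨⟨σ, rfl⟩, ⟨AlgEquiv.restrictScalarsHom ℚ σ, hσ, rfl⟩⟩
    · rintro ⟨⟨σ, rfl⟩, ⟨τ, hτ, hτσ⟩⟩
      refine ⟨σ, ?_, rfl⟩
      have : τ = AlgEquiv.restrictScalarsHom ℚ σ := (galEquivZMod m K).injective hτσ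
      subst this
      exact hτ
  rw [← h]
  exact Nat.card_congr ((stabilizer Gal(K/maximalRealSubfield K) P).equivMapOfInjective _
    (galRealEmbedding_injective m K)).toEquiv

/-- The residue degree is `|⟨q⟩|` over `ℚ` and `|⟨-1⟩ ⊓ ⟨q⟩|` over `K⁺`, the latter because the
stabilizer has order `e * f` with `e = 1`. Multiplicativity in towers leaves the quotient. -/
theorem inertiaDeg_and_ramificationIdx_maximalRealSubfield [IsCMField K] (hqm : q.Coprime m)
    (v : Ideal (𝓞 (maximalRealSubfield K))) [v.IsPrime] [v.LiesOver (Ideal.span {(q : ℤ)})] :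
    v.inertiaDeg ℤ = (Subgroup.zpowers (-1)).relIndex
      (Subgroup.zpowers (ZMod.unitOfCoprime q hqm)) ∧ v.ramificationIdx ℤ = 1 := by
  have hnd : ¬ q ∣ m := (Nat.Prime.coprime_iff_not_dvd hq.out).mp hqm
  have : v.IsMaximal := .of_liesOver_isMaximal v (Ideal.span {(q : ℤ)})
  obtain ⟨P, hP, hPv⟩ := Ideal.exists_maximal_ideal_liesOver_of_isIntegral (S := 𝓞 K) v
  have : P.LiesOver (Ideal.span {(q : ℤ)}) := .trans P v _
  have hf := Ideal.inertiaDeg_tower (R := ℤ) v P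
  have he := Ideal.ramificationIdx_tower (R := ℤ) v P
  rw [ramificationIdx_eq_of_not_dvd (m := m) q K P hnd] at he
  rw [inertiaDeg_eq_of_not_dvd (m := m) q K P hnd] at hf
  have he1 := Nat.eq_one_of_mul_eq_one_right he.symm
  have he2 := Nat.eq_one_of_mul_eq_one_left he.symm
  refine ⟨?_, he1⟩
  have hs := Ideal.card_stabilizer_eq (G := Gal(K/maximalRealSubfield K)) v P
  rw [Ideal.ramificationIdxIn_eq_ramificationIdx v P Gal(K/maximalRealSubfield K),
    Ideal.inertiaDegIn_eq_inertiaDeg v P Gal(K/maximalRealSubfield K), he2, one_mul,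
    card_stabilizer_galReal m K q hqm] at hs
  set H : Subgroup (ZMod m)ˣ := Subgroup.zpowers (-1)
  set U := Subgroup.zpowers (ZMod.unitOfCoprime q hqm) with hU
  have h1 : orderOf (q : ZMod m) = Nat.card U := by
    rw [hU, Nat.card_zpowers, ← orderOf_units, ZMod.coe_unitOfCoprime]
  have h2 := Subgroup.relIndex_mul_relIndex ⊥ (H ⊓ U) U bot_le inf_le_right
  rw [Subgroup.relIndex_bot_left, Subgroup.relIndex_bot_left, Subgroup.inf_relIndex_right] at h2
  rw [h1, ← h2, ← hs, mul_comm] at hf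
  exact (Nat.eq_of_mul_eq_mul_right (hs ▸ Nat.card_pos) hf).symm

end Splitting

/-! ### Finite places over rational primes and convergence of Euler products -/

section PrimesAbove

theorem exists_natPrime_mem_asIdeal {F : Type*} [Field F] [CharZero F]
    (v : HeightOneSpectrum (𝓞 F)) :
    ∃ q : Nat.Primes, (q.1 : 𝓞 F) ∈ v.asIdeal := by
  have hne : v.asIdeal.under ℤ ≠ ⊥ := mt Ideal.eq_bot_of_comap_eq_bot v.ne_bot
  have hP : (v.asIdeal.under ℤ).IsPrime := .under ℤ v.asIdeal
  obtain ⟨a, ha⟩ := IsPrincipalIdealRing.principal (v.asIdeal.under ℤ)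
  rw [Ideal.submodule_span_eq] at ha
  have ha0 : a ≠ 0 := by rintro rfl; simp [ha] at hne
  have hap : Prime a := (Ideal.span_singleton_prime ha0).mp (ha ▸ hP)
  refine ⟨⟨a.natAbs, Int.prime_iff_natAbs_prime.mp hap⟩, ?_⟩
  have h1 : (a.natAbs : ℤ) ∈ v.asIdeal.under ℤ := by
    rw [ha, Ideal.mem_span_singleton]; exact Int.dvd_natAbs.mpr dvd_rfl
  simpa using Ideal.mem_comap.mp h1

variable (F : Type*) [Field F] [NumberField F] (q : ℕ) [hq : Fact q.Prime]

/-- The finite places of `F` above the rational prime `q`. -/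
noncomputable def primesAbove : Finset (HeightOneSpectrum (𝓞 F)) :=
  Set.Finite.toFinset (s := {v : HeightOneSpectrum (𝓞 F) | (q : 𝓞 F) ∈ v.asIdeal}) <| by
    have h : Ideal.span {(q : 𝓞 F)} ≠ 0 := by simpa using hq.out.ne_zero
    refine (Ideal.finite_factors h).subset fun v hv => ?_
    simpa [Ideal.dvd_span_singleton] using hv

variable {F q}

theorem mem_primesAbove {v : HeightOneSpectrum (𝓞 F)} :
    v ∈ primesAbove F q ↔ (q : 𝓞 F) ∈ v.asIdeal := by
  simp [primesAbove]

theorem primesAboveTwo_eq : primesAboveTwo F = primesAbove F 2 := by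
  ext v
  simp [mem_primesAbove, primesAboveTwo]

theorem mem_primesAbove_iff_liesOver {v : HeightOneSpectrum (𝓞 F)} :
    v ∈ primesAbove F q ↔ v.asIdeal.LiesOver (Ideal.span {(q : ℤ)}) := by
  have hprime : Prime (q : ℤ) := Nat.prime_iff_prime_int.mp hq.out
  rw [mem_primesAbove, Ideal.liesOver_iff]
  constructor
  · intro h
    have hmax := PrincipalIdealRing.isMaximal_of_irreducible hprime.irreducible
    refine hmax.eq_of_le (Ideal.IsPrime.under ℤ v.asIdeal).ne_top ?_
    rw [Ideal.span_singleton_le_iff_mem, Ideal.mem_comap]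
    simpa using h
  · intro h
    have h1 : (q : ℤ) ∈ v.asIdeal.under ℤ := h ▸ Ideal.mem_span_singleton_self _
    simpa using Ideal.mem_comap.mp h1

theorem sum_ramificationIdx_mul_inertiaDeg_primesAbove :
    ∑ v ∈ primesAbove F q, v.asIdeal.ramificationIdx ℤ * v.asIdeal.inertiaDeg ℤ =
      Module.finrank ℚ F := by
  have hprime : Prime (q : ℤ) := Nat.prime_iff_prime_int.mp hq.out
  have h0 : Ideal.span {(q : ℤ)} ≠ ⊥ := by simpa using hq.out.ne_zero
  have hmax := PrincipalIdealRing.isMaximal_of_irreducible hprime.irreducible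
  rw [← RingOfIntegers.rank F,
    ← Ideal.sum_ramification_inertia_eq_finrank (Ideal.span {(q : ℤ)}) (𝓞 F)]
  refine Finset.sum_bij (fun v hv => ⟨v.asIdeal, v.isPrime, mem_primesAbove_iff_liesOver.mp hv⟩)
    (fun _ _ => Finset.mem_univ _) (fun v _ w _ h => HeightOneSpectrum.ext (congrArg Subtype.val h))
    (fun P _ => ?_) (fun _ _ => rfl)
  exact ⟨⟨P.1, P.2.1, Ideal.ne_bot_of_mem_primesOver h0 P.2⟩,
    mem_primesAbove_iff_liesOver.mpr P.2.2, rfl⟩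

theorem eq_of_mem_primesAbove {v : HeightOneSpectrum (𝓞 F)} {q r : Nat.Primes}
    (hq : (q.1 : 𝓞 F) ∈ v.asIdeal) (hr : (r.1 : 𝓞 F) ∈ v.asIdeal) : q = r := by
  by_contra h
  have hc : IsCoprime (q.1 : ℤ) (r.1 : ℤ) := Nat.isCoprime_iff_coprime.mpr
    ((Nat.coprime_primes q.2 r.2).mpr fun h' => h (Subtype.ext h'))
  obtain ⟨a, b, hab⟩ := hc
  refine v.isPrime.ne_top ((Ideal.eq_top_iff_one _).mpr ?_)
  have : (1 : 𝓞 F) = (a : 𝓞 F) * (q.1 : 𝓞 F) + (b : 𝓞 F) * (r.1 : 𝓞 F) := by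
    exact_mod_cast hab.symm
  rw [this]
  exact v.asIdeal.add_mem (v.asIdeal.mul_mem_left _ hq) (v.asIdeal.mul_mem_left _ hr)

theorem prime_le_absNorm {v : HeightOneSpectrum (𝓞 F)} (hv : v ∈ primesAbove F q) :
    q ≤ Ideal.absNorm v.asIdeal := by
  have := mem_primesAbove_iff_liesOver.mp hv
  rw [← Ideal.pow_inertiaDeg q v.asIdeal]
  exact Nat.le_self_pow (Ideal.inertiaDeg_pos _ _).ne' q

theorem card_primesAbove_le_finrank : (primesAbove F q).card ≤ Module.finrank ℚ F := by
  rw [← sum_ramificationIdx_mul_inertiaDeg_primesAbove (F := F) (q := q), Finset.card_eq_sum_ones]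
  refine Finset.sum_le_sum fun v _ => ?_
  exact Nat.mul_pos (Ideal.ramificationIdx_pos _ _) (Ideal.inertiaDeg_pos _ _)

/-- The rational prime below a finite place. -/
noncomputable def primeBelow (v : HeightOneSpectrum (𝓞 F)) : Nat.Primes :=
  (exists_natPrime_mem_asIdeal v).choose

theorem primeBelow_eq_iff {v : HeightOneSpectrum (𝓞 F)} {q : Nat.Primes} :
    primeBelow v = q ↔ (q.1 : 𝓞 F) ∈ v.asIdeal := by
  have h := (exists_natPrime_mem_asIdeal v).choose_spec
  exact ⟨fun e => e ▸ h, fun h' => eq_of_mem_primesAbove h h'⟩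

theorem mem_primesAbove_iff_primeBelow {q : Nat.Primes} {v : HeightOneSpectrum (𝓞 F)} :
    v ∈ @primesAbove F _ _ q.1 ⟨q.2⟩ ↔ primeBelow v = q := by
  have := Fact.mk q.2
  rw [mem_primesAbove, primeBelow_eq_iff]

noncomputable instance (q : Nat.Primes) :
    Fintype {v : HeightOneSpectrum (𝓞 F) // primeBelow v = q} :=
  Fintype.subtype (@primesAbove F _ _ q.1 ⟨q.2⟩) fun _ => mem_primesAbove_iff_primeBelow

-- At most `[F : ℚ]` places lie above `q`, each of norm at least `q`; compare with the sum of `q ^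
-- (-σ)` over primes.
variable (F) in
theorem summable_absNorm_rpow {σ : ℝ} (hσ : 1 < σ) :
    Summable fun v : HeightOneSpectrum (𝓞 F) => (Ideal.absNorm v.asIdeal : ℝ) ^ (-σ) := by
  rw [← (Equiv.sigmaFiberEquiv (primeBelow (F := F))).summable_iff]
  refine (summable_sigma_of_nonneg fun _ => Real.rpow_nonneg (Nat.cast_nonneg _) _).mpr ?_
  refine ⟨fun q => (hasSum_fintype _).summable, ?_⟩
  have hs : Summable fun q : Nat.Primes => (Module.finrank ℚ F : ℝ) * (q.1 : ℝ) ^ (-σ) :=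
    (Nat.Primes.summable_rpow.mpr (by linarith)).mul_left _
  refine hs.of_nonneg_of_le
    (fun q => tsum_nonneg fun _ => Real.rpow_nonneg (Nat.cast_nonneg _) _) fun q => ?_
  have := Fact.mk q.2
  rw [tsum_fintype]
  change ∑ v : {v : HeightOneSpectrum (𝓞 F) // primeBelow v = q},
    (Ideal.absNorm v.1.asIdeal : ℝ) ^ (-σ) ≤ _
  rw [← Finset.sum_subtype (primesAbove F q.1) (fun v => mem_primesAbove_iff_primeBelow)
    (fun v => (Ideal.absNorm v.asIdeal : ℝ) ^ (-σ))]
  refine (Finset.sum_le_card_nsmul _ _ ((q.1 : ℝ) ^ (-σ)) fun v hv => ?_).trans ?_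
  · exact Real.rpow_le_rpow_of_nonpos (Nat.cast_pos.mpr q.2.pos)
      (Nat.cast_le.mpr (prime_le_absNorm hv)) (by linarith)
  · rw [nsmul_eq_mul]
    gcongr
    exact card_primesAbove_le_finrank

theorem one_lt_absNorm (v : HeightOneSpectrum (𝓞 F)) : 1 < Ideal.absNorm v.asIdeal := by
  obtain ⟨q, hq⟩ := exists_natPrime_mem_asIdeal v
  have := Fact.mk q.2
  exact q.2.one_lt.trans_le (prime_le_absNorm (mem_primesAbove.mpr hq))

theorem norm_absNorm_cpow (v : HeightOneSpectrum (𝓞 F)) (s : ℂ) :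
    ‖(Ideal.absNorm v.asIdeal : ℂ) ^ (-s)‖ = (Ideal.absNorm v.asIdeal : ℝ) ^ (-s.re) := by
  rw [Complex.norm_natCast_cpow_of_pos (zero_lt_one.trans (one_lt_absNorm v)), Complex.neg_re]

variable (F) in
theorem multipliable_eulerFactor {s : ℂ} (hs : 1 < s.re) :
    Multipliable fun v : HeightOneSpectrum (𝓞 F) => eulerFactor v s := by
  have hsum := summable_absNorm_rpow F hs
  have hle : ∀ v : HeightOneSpectrum (𝓞 F), ‖(Ideal.absNorm v.asIdeal : ℂ) ^ (-s)‖ ≤ 1 / 2 := by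
    intro v
    have h2 : (2 : ℝ) ≤ Ideal.absNorm v.asIdeal := by exact_mod_cast one_lt_absNorm v
    rw [norm_absNorm_cpow]
    calc (Ideal.absNorm v.asIdeal : ℝ) ^ (-s.re) ≤ (Ideal.absNorm v.asIdeal : ℝ) ^ (-1 : ℝ) :=
          Real.rpow_le_rpow_of_exponent_le (by linarith) (by linarith)
      _ ≤ 1 / 2 := by
        rw [Real.rpow_neg_one, one_div]
        exact inv_anti₀ two_pos h2
  have hlow : ∀ v : HeightOneSpectrum (𝓞 F),
      1 / 2 ≤ ‖1 - (Ideal.absNorm v.asIdeal : ℂ) ^ (-s)‖ := by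
    intro v
    have := norm_sub_norm_le (1 : ℂ) ((Ideal.absNorm v.asIdeal : ℂ) ^ (-s))
    rw [norm_one] at this
    linarith [hle v]
  have key : Summable fun v : HeightOneSpectrum (𝓞 F) => ‖eulerFactor v s - 1‖ := by
    refine (hsum.mul_left 2).of_nonneg_of_le (fun _ => norm_nonneg _) fun v => ?_
    have hne : 1 - (Ideal.absNorm v.asIdeal : ℂ) ^ (-s) ≠ 0 := by
      intro h
      have := hlow v
      rw [h, norm_zero] at this
      norm_num at this
    have heq : eulerFactor v s - 1 = (Ideal.absNorm v.asIdeal : ℂ) ^ (-s) /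
        (1 - (Ideal.absNorm v.asIdeal : ℂ) ^ (-s)) := by
      rw [eulerFactor]; field_simp; ring
    rw [heq, norm_div, norm_absNorm_cpow, div_le_iff₀ (by linarith [hlow v])]
    have h0 : 0 ≤ (Ideal.absNorm v.asIdeal : ℝ) ^ (-s.re) := Real.rpow_nonneg (Nat.cast_nonneg _) _
    nlinarith [hlow v]
  simpa using multipliable_one_add_of_summable key

/-- Multipliability over all places allows regrouping by the rational prime below. -/
theorem hasProd_eulerFactor {s : ℂ} (hs : 1 < s.re) {g : Nat.Primes → ℂ} {a : ℂ}
    (hg : HasProd g a)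
    (h : ∀ q : Nat.Primes, ∏ v ∈ @primesAbove F _ _ q.1 ⟨q.2⟩, eulerFactor v s = g q) :
    HasProd (fun v : HeightOneSpectrum (𝓞 F) => eulerFactor v s) a := by
  rw [← (Equiv.sigmaFiberEquiv (primeBelow (F := F))).hasProd_iff]
  refine HasProd.sigma_of_hasProd hg (fun q => ?_)
    ((Equiv.sigmaFiberEquiv (primeBelow (F := F))).multipliable_iff.mpr
      (multipliable_eulerFactor F hs))
  have := Fact.mk q.2
  rw [← h q, Finset.prod_subtype (primesAbove F q.1) (fun v => mem_primesAbove_iff_primeBelow)]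
  exact hasProd_fintype _

end PrimesAbove

/-! ### The local identity at each rational prime -/

section LocalFactors

variable {p : ℕ} [hp : Fact p.Prime] (n : ℕ)

instance neZero_conductor {m : ℕ} [NeZero m] (χ : DirichletCharacter ℂ m) :
    NeZero χ.conductor := ⟨DirichletCharacter.conductor_ne_zero χ⟩

variable (p) in
theorem two_lt_prime_pow (hp2 : p ≠ 2) : 2 < p ^ (n + 1) :=
  (lt_of_le_of_ne hp.out.two_le hp2.symm).trans_le (Nat.le_self_pow n.succ_ne_zero p)

theorem primitiveCharacter_natCast_of_coprime {m q : ℕ} [NeZero m] (χ : DirichletCharacter ℂ m)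
    (hq : q.Coprime m) :
    χ.primitiveCharacter (q : ZMod χ.conductor) = χ (ZMod.unitOfCoprime q hq) := by
  have := χ.primitiveCharacter_apply_of_isCoprime (Nat.isCoprime_iff_coprime.mpr hq)
  simpa using this

variable {n} in
-- The conductor of a nontrivial `χ` is a positive power of `p`, so `p` is not a unit modulo it.
theorem primitiveCharacter_prime_of_ne_one {χ : DirichletCharacter ℂ (p ^ (n + 1))} (hχ : χ ≠ 1) :
    χ.primitiveCharacter (p : ZMod χ.conductor) = 0 := by
  refine χ.primitiveCharacter.map_nonunit fun h => hχ ?_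
  rw [DirichletCharacter.eq_one_iff_conductor_eq_one]
  obtain ⟨k, -, hk⟩ := (Nat.dvd_prime_pow hp.out).mp χ.conductor_dvd_level
  rw [ZMod.isUnit_iff_coprime, hk] at h
  rcases Nat.eq_zero_or_pos k with rfl | hk0
  · simpa using hk
  · exact absurd ((Nat.coprime_pow_right_iff hk0 _ _).mp h) (by simpa using hp.out.ne_one)

theorem isCMField_of_prime_pow (n : ℕ) (K : Type*) [Field K] [NumberField K]
    [IsCyclotomicExtension {p ^ (n + 1)} ℚ K] (hp2 : p ≠ 2) : IsCMField K :=
  IsCyclotomicExtension.Rat.isCMField (S := {p ^ (n + 1)}) K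
    ⟨p ^ (n + 1), rfl, two_lt_prime_pow p n hp2⟩

/-- The only prime of `K` above `p` is `(ζ - 1)`, of residue degree `1`, so each place of `K⁺` above
`p` is its contraction. -/
theorem exists_primesAbove_self_eq_singleton (n : ℕ) (K : Type*) [Field K]
    [NumberField K] [IsCyclotomicExtension {p ^ (n + 1)} ℚ K] [IsCMField K] :
    ∃ v, primesAbove (maximalRealSubfield K) p = {v} ∧ Ideal.absNorm v.asIdeal = p := by
  have hζ := IsCyclotomicExtension.zeta_spec (p ^ (n + 1)) ℚ K
  have key : ∀ v ∈ primesAbove (maximalRealSubfield K) p,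
      (v.asIdeal = (Ideal.span {hζ.toInteger - 1}).under (𝓞 (maximalRealSubfield K))) ∧
        Ideal.absNorm v.asIdeal = p := by
    intro v hv
    have h1 := mem_primesAbove_iff_liesOver.mp hv
    obtain ⟨P, hP, hPv⟩ := Ideal.exists_maximal_ideal_liesOver_of_isIntegral (S := 𝓞 K) v.asIdeal
    have : P.LiesOver (Ideal.span {(p : ℤ)}) := .trans P v.asIdeal _
    have hf := Ideal.inertiaDeg_tower (R := ℤ) v.asIdeal P
    rw [inertiaDeg_eq_of_prime_pow p n K P] at hf
    rw [← eq_span_zeta_sub_one_of_liesOver p n K hζ P, ← Ideal.pow_inertiaDeg p v.asIdeal,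
      Nat.eq_one_of_mul_eq_one_right hf.symm, pow_one]
    exact ⟨hPv.over, rfl⟩
  have hne : (primesAbove (maximalRealSubfield K) p).Nonempty := by
    by_contra h
    have h2 := sum_ramificationIdx_mul_inertiaDeg_primesAbove (F := maximalRealSubfield K) (q := p)
    rw [Finset.not_nonempty_iff_eq_empty.mp h, Finset.sum_empty] at h2
    exact Module.finrank_pos.ne h2
  obtain ⟨v, hv⟩ := hne
  refine ⟨v, Finset.eq_singleton_iff_unique_mem.mpr ⟨hv, fun w hw => ?_⟩, (key v hv).2⟩
  exact HeightOneSpectrum.ext ((key w hw).1.trans (key v hv).1.symm)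

theorem prod_primesAbove_one_sub (n : ℕ) (K : Type*) [Field K] [NumberField K]
    [IsCyclotomicExtension {p ^ (n + 1)} ℚ K] (hp2 : p ≠ 2) (q : ℕ) [hq : Fact q.Prime] (z : ℂ) :
    ∏ v ∈ primesAbove (maximalRealSubfield K) q, (1 - (Ideal.absNorm v.asIdeal : ℂ) ^ z) =
      ∏ χ ∈ evenCharacters (p ^ (n + 1)), (1 - χ.primitiveCharacter q * (q : ℂ) ^ z) := by
  have := isCMField_of_prime_pow n K hp2
  rcases eq_or_ne q p with rfl | hqp
  · obtain ⟨v, hv, hnorm⟩ := exists_primesAbove_self_eq_singleton (p := q) n K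
    rw [hv, Finset.prod_singleton, hnorm, Finset.prod_eq_single 1]
    · rw [DirichletCharacter.primitiveCharacter_one, MulChar.one_apply, one_mul]
      rw [ZMod.isUnit_iff_coprime, DirichletCharacter.conductor_one]
      exact Nat.coprime_one_right q
    · intro χ _ hχ
      rw [primitiveCharacter_prime_of_ne_one hχ, zero_mul, sub_zero]
    · intro h
      refine absurd (mem_evenCharacters.mpr ?_) h
      simp [DirichletCharacter.Even, MulChar.one_apply]
  · have hqm : q.Coprime (p ^ (n + 1)) :=
      Nat.Coprime.pow_right _ ((Nat.coprime_primes hq.out hp.out).mpr hqp)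
    obtain ⟨g, hg, hprod⟩ := prod_evenCharacters_one_sub (ZMod.unitOfCoprime q hqm) ((q : ℂ) ^ z)
    set d := (Subgroup.zpowers (-1)).relIndex (Subgroup.zpowers (ZMod.unitOfCoprime q hqm)) with hd
    have hloc : ∀ v ∈ primesAbove (maximalRealSubfield K) q,
        v.asIdeal.inertiaDeg ℤ = d ∧ v.asIdeal.ramificationIdx ℤ = 1 := fun v hv => by
      have := mem_primesAbove_iff_liesOver.mp hv
      exact inertiaDeg_and_ramificationIdx_maximalRealSubfield (p ^ (n + 1)) K q hqm v.asIdeal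
    -- Both sides equal `[K⁺ : ℚ]`: the left by `∑ e f`, the right as the number of even characters.
    have hcard : (primesAbove (maximalRealSubfield K) q).card * d = g * d := by
      rw [hg, card_evenCharacters, index_zpowers_neg_one (p ^ (n + 1)) K,
        ← sum_ramificationIdx_mul_inertiaDeg_primesAbove (F := maximalRealSubfield K) (q := q),
        Finset.sum_congr rfl fun v hv => by rw [(hloc v hv).1, (hloc v hv).2, one_mul],
        Finset.sum_const, smul_eq_mul]
    have hd0 : 0 < d := Nat.pos_of_dvd_of_pos (Subgroup.relIndex_dvd_card _ _) Nat.card_pos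
    simp_rw [primitiveCharacter_natCast_of_coprime _ hqm]
    rw [hprod, ← Nat.eq_of_mul_eq_mul_right hd0 hcard, ← Finset.prod_const]
    refine Finset.prod_congr rfl fun v hv => ?_
    have := mem_primesAbove_iff_liesOver.mp hv
    rw [← Ideal.pow_inertiaDeg q v.asIdeal, (hloc v hv).1, Nat.cast_pow,
      ← Complex.natCast_cpow_natCast_mul, Complex.cpow_nat_mul]

end LocalFactors

/-! ### Meromorphy, uniqueness and assembly -/

theorem meromorphicAt_LFunction_one {f : ℕ} [NeZero f] (χ : DirichletCharacter ℂ f) :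
    MeromorphicAt χ.LFunction 1 := by
  -- The pole is at most simple, but with exponent `2` the limit at `1` is `0` whatever the residue,
  -- matching the value there.
  refine ⟨2, ?_⟩
  refine Complex.analyticAt_of_differentiable_on_punctured_nhds_of_continuousAt ?_ ?_
  · filter_upwards [self_mem_nhdsWithin] with z hz
    exact ((differentiableAt_id.sub_const 1).pow 2).smul
      (χ.differentiableAt_LFunction z (.inl hz))
  · rw [continuousAt_iff_punctured_nhds]
    have h1 : Tendsto (fun s : ℂ => s - 1) (𝓝[≠] 1) (𝓝 0) := by
      have : Tendsto (fun s : ℂ => s - 1) (𝓝 1) (𝓝 (1 - 1)) := tendsto_id.sub_const 1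
      rw [sub_self] at this
      exact this.mono_left nhdsWithin_le_nhds
    have h2 := h1.mul (ZMod.LFunction_residue_one (fun j => χ j))
    rw [zero_mul] at h2
    simp only [sub_self, smul_eq_mul, ne_eq, OfNat.ofNat_ne_zero, not_false_eq_true, zero_pow,
      zero_mul]
    refine h2.congr fun s => ?_
    rw [DirichletCharacter.LFunction]
    ring

theorem IsRefinedZeta.unique {F : Type*} [Field F] [NumberField F]
    {S T : Finset (HeightOneSpectrum (𝓞 F))} {Z Z' : ℂ → ℂ}
    (hZ : IsRefinedZeta F S T Z) (hZ' : IsRefinedZeta F S T Z') : Z = Z' := by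
  obtain ⟨ζ, hζ, h⟩ := hZ.eq_mul
  obtain ⟨ζ', hζ', h'⟩ := hZ'.eq_mul
  refine AnalyticOnNhd.eq_of_eventuallyEq (z₀ := 2) (fun z _ => hZ.differentiable.analyticAt z)
    (fun z _ => hZ'.differentiable.analyticAt z) ?_
  filter_upwards [(isOpen_lt continuous_const Complex.continuous_re).mem_nhds
    (show (1 : ℝ) < (2 : ℂ).re by simp)] with z hz
  have hz : 1 < z.re := hz
  have hz1 : z ≠ 1 := by rintro rfl; simp at hz
  rw [h z hz1, h' z hz1, (hζ.hasProd z hz).unique (hζ'.hasProd z hz)]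

section Main

variable {p : ℕ} [hp : Fact p.Prime]

theorem odd_conductor (hp2 : p ≠ 2) {n : ℕ} (χ : DirichletCharacter ℂ (p ^ (n + 1))) :
    Odd χ.conductor :=
  ((hp.out.odd_of_ne_two hp2).pow).of_dvd_nat χ.conductor_dvd_level

theorem isZetaS_prod_LFunction (n : ℕ) (K : Type*) [Field K] [NumberField K]
    [IsCyclotomicExtension {p ^ (n + 1)} ℚ K] (hp2 : p ≠ 2) :
    IsZetaS (maximalRealSubfield K) ∅
      (fun s => ∏ χ ∈ evenCharacters (p ^ (n + 1)), χ.primitiveCharacter.LFunction s) where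
  hasProd s hs := by
    have h1 := hasProd_prod (s := evenCharacters (p ^ (n + 1))) fun χ _ =>
      χ.primitiveCharacter.LSeries_eulerProduct_hasProd hs
    have h2 := hasProd_eulerFactor (F := maximalRealSubfield K) hs h1 fun q => by
      have := Fact.mk q.2
      rw [Finset.prod_inv_distrib, ← prod_primesAbove_one_sub n K hp2 q.1 (-s),
        ← Finset.prod_inv_distrib]
      rfl
    simp_rw [DirichletCharacter.LFunction_eq_LSeries _ hs]
    exact (Equiv.subtypeUnivEquiv (p := fun v => v ∉ (∅ : Finset _))
      fun v => Finset.notMem_empty v).hasProd_iff.mpr h2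
  differentiableOn := DifferentiableOn.fun_finsetProd fun χ _ z hz =>
    (χ.primitiveCharacter.differentiableAt_LFunction z (.inl hz)).differentiableWithinAt
  meromorphicAt_one := .fun_prod fun χ _ => meromorphicAt_LFunction_one χ.primitiveCharacter

theorem card_evenCharacters_eq_totient_div_two (n : ℕ) (K : Type*) [Field K] [NumberField K]
    [IsCyclotomicExtension {p ^ (n + 1)} ℚ K] (hp2 : p ≠ 2) :
    (evenCharacters (p ^ (n + 1))).card = Nat.totient (p ^ (n + 1)) / 2 := by
  have := isCMField_of_prime_pow n K hp2
  have h := Module.finrank_mul_finrank ℚ (maximalRealSubfield K) K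
  rw [Algebra.IsQuadraticExtension.finrank_eq_two (maximalRealSubfield K) K,
    IsCyclotomicExtension.finrank (n := p ^ (n + 1)) K
      (Polynomial.cyclotomic.irreducible_rat (NeZero.pos _))] at h
  rw [card_evenCharacters, index_zpowers_neg_one (p ^ (n + 1)) K, ← h, Nat.mul_div_cancel _ two_pos]

/-- Each factor is half of an Euler `L`-function and is entire, so this product also supplies the
removable value at `s = 1`. -/
theorem isRefinedZeta_prod_alternating (n : ℕ) (K : Type*) [Field K] [NumberField K]
    [IsCyclotomicExtension {p ^ (n + 1)} ℚ K] (hp2 : p ≠ 2) :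
    IsRefinedZeta (maximalRealSubfield K) ∅ (primesAboveTwo (maximalRealSubfield K))
      (fun s => (-1) ^ (Nat.totient (p ^ (n + 1)) / 2) *
        ∏ χ ∈ evenCharacters (p ^ (n + 1)),
          ZMod.LFunction (alternating χ.primitiveCharacter) s) where
  differentiable := (Differentiable.fun_finsetProd fun χ _ =>
    ZMod.differentiable_LFunction_of_sum_zero
      (sum_alternating (odd_conductor hp2 χ) χ.primitiveCharacter)).const_mul _
  eq_mul := by
    refine ⟨_, isZetaS_prod_LFunction n K hp2, fun s hs => ?_⟩
    have h2 := prod_primesAbove_one_sub n K hp2 2 (1 - s)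
    rw [primesAboveTwo_eq, h2, ← Finset.prod_mul_distrib,
      ← card_evenCharacters_eq_totient_div_two n K hp2, ← Finset.prod_const,
      ← Finset.prod_mul_distrib]
    refine Finset.prod_congr rfl fun χ _ => ?_
    rw [LFunction_alternating (odd_conductor hp2 χ) _ hs]
    push_cast
    ring

end Main

end RefinedZeta

theorem proposition3p2 (p : ℕ) [Fact p.Prime] (hp : p ≠ 2) (n : ℕ)
    (K : Type*) [Field K] [NumberField K] [IsCyclotomicExtension {p ^ (n + 1)} ℚ K] :
    (∃! Z : ℂ → ℂ, RefinedZeta.IsRefinedZeta (maximalRealSubfield K) ∅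
      (RefinedZeta.primesAboveTwo (maximalRealSubfield K)) Z) ∧
    (∀ χ ∈ RefinedZeta.evenCharacters (p ^ (n + 1)),
      ∃! L : ℂ → ℂ, RefinedZeta.IsEulerLFunction χ.primitiveCharacter L) ∧
    ∀ (Z : ℂ → ℂ) (L : DirichletCharacter ℂ (p ^ (n + 1)) → ℂ → ℂ),
      RefinedZeta.IsRefinedZeta (maximalRealSubfield K) ∅
        (RefinedZeta.primesAboveTwo (maximalRealSubfield K)) Z →
      (∀ χ ∈ RefinedZeta.evenCharacters (p ^ (n + 1)),
        RefinedZeta.IsEulerLFunction χ.primitiveCharacter (L χ)) →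
      ∀ s : ℂ, Z s = (-1) ^ (Nat.totient (p ^ (n + 1)) / 2) *
        ∏ χ ∈ RefinedZeta.evenCharacters (p ^ (n + 1)), (1 / 2 : ℂ) * L χ s := by
  have hZ₀ := RefinedZeta.isRefinedZeta_prod_alternating n K hp
  have hL₀ := fun χ : DirichletCharacter ℂ (p ^ (n + 1)) =>
    RefinedZeta.isEulerLFunction_LFunction_alternating (RefinedZeta.odd_conductor hp χ)
      χ.primitiveCharacter
  refine ⟨⟨_, hZ₀, fun Z hZ => hZ.unique hZ₀⟩, fun χ _ => ⟨_, hL₀ χ, fun L hL => hL.unique (hL₀ χ)⟩,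
    fun Z L hZ hL s => ?_⟩
  rw [hZ.unique hZ₀]
  refine congrArg _ (Finset.prod_congr rfl fun χ hχ => ?_)
  rw [(hL χ hχ).unique (hL₀ χ)]
  ring
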